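/- Fix $\lambda\ge 0$, $t\in[0,1]$, $r\in(0,1]$ and integers $m_N$ with $m_N<N$ for all large $N$ and $m_N/N\to k$ as $N\to\infty$. For each $N$, let $(V,E)$ be a directed Erdős–Rényi graph on $N$ users: each of the $N(N-1)$ ordered pairs $(i,j)$, $i\ne j$, is an edge ("$i$ trusts $j$") independently with probability $\lambda/N$. Independently of the graph, let the set $N_R$ of raters be a uniformly random set of $m_N$ users. Every edge carries the trust value $t$ and every rater gives the rating $r$. The satisfaction scores $(s_i)_{i\in V}$, with equal weights for raters and non-raters ($\alpha=1/2$), are the unique vector such that $s_i=r$ if $i\in N_R$; if $i\notin N_R$, $$s_i=\frac{\alpha\sum_{j\in N(i)\cap N_R}t^2s_j+(1-\alpha)\sum_{j\in N(i)\setminus N_R}t^2s_j}{\alpha\sum_{j\in N(i)\cap N_R}t+(1-\alpha)\sum_{j\in N(i)\setminus N_R}t},\qquad N(i)=\{j:(i,j)\in E\}$$ (read as $0$ when the denominator is $0$); and $s_i=0$ if $i\notin N_R$ and no directed path of edges leads from $i$ to a rater. Then the expected satisfaction score of a non-rater converges, as $N\to\infty$, to $$\frac{t\,r\,k\,(1-e^{-\lambda})}{1-t(1-k)(1-e^{-\lambda})}.$$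 This holds both for the expected score of a non-rater picked uniformly at random among the non-raters, and, uniformly in $i$, for the conditional expectation of $s_i$ given that user $i$ is a non-rater. -/

import Mathlib

open Filter Topology MeasureTheory ProbabilityTheory

namespace TrustNetwork

section Scores

variable {V : Type*}

/-- User `i` trusts, directly or indirectly, some rater: there is a nonempty directed path of
edges of `E` from `i` to an element of the set `R` of raters. An edge `(i, j)` means that `i`
trusts `j`. -/
def TrustsSomeRater (E : Set (V × V)) (R : Set V) (i : V) : Prop :=
  ∃ j ∈ R, Relation.TransGen (fun a b => (a, b) ∈ E) i j

open scoped Classical in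
/-- The set `N_R(i)` of raters that `i` trusts directly. -/
noncomputable def raterNbrs [Fintype V] (E : Set (V × V)) (R : Set V) (i : V) : Finset V :=
  {j | (i, j) ∈ E ∧ j ∈ R}

open scoped Classical in
/-- The set `N_N(i)` of non-raters that `i` trusts directly. -/
noncomputable def nonRaterNbrs [Fintype V] (E : Set (V × V)) (R : Set V) (i : V) : Finset V :=
  {j | (i, j) ∈ E ∧ j ∉ R}

/-- The weighted mean that defines the score of a non-rater `i` from the scores `s` of the users
that he trusts, with trust values `T` and with weight `α` for raters and `1 - α` for non-raters.
When the denominator vanishes (no trustees, or only trustees with trust value `0`), the value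
is `0`. -/
noncomputable def weightedMean [Fintype V] (α : ℝ) (E : Set (V × V)) (T : V → V → ℝ) (R : Set V)
    (s : V → ℝ) (i : V) : ℝ :=
  (α * ∑ j ∈ raterNbrs E R i, T i j ^ 2 * s j
      + (1 - α) * ∑ j ∈ nonRaterNbrs E R i, T i j ^ 2 * s j) /
    (α * ∑ j ∈ raterNbrs E R i, T i j + (1 - α) * ∑ j ∈ nonRaterNbrs E R i, T i j)

/-- `s` is a vector of satisfaction scores of the trust network with edge set `E`, trust values
`T`, set of raters `R`, ratings `ρ` and rater weight `α`. -/
structure IsScore [Fintype V] (α : ℝ) (E : Set (V × V)) (T : V → V → ℝ) (R : Set V) (ρ : V → ℝ)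
    (s : V → ℝ) : Prop where
  /-- the score of a rater is his rating -/
  rater : ∀ i ∈ R, s i = ρ i
  /-- the score of a non-rater is the weighted mean over the users that he trusts -/
  nonRater : ∀ i ∉ R, s i = weightedMean α E T R s i
  /-- a non-rater who does not trust any rater, even indirectly, has score `0` -/
  noTrust : ∀ i ∉ R, ¬ TrustsSomeRater E R i → s i = 0

/-- The satisfaction scores: the vector that satisfies `IsScore`. -/
noncomputable def score [Fintype V] (α : ℝ) (E : Set (V × V)) (T : V → V → ℝ) (R : Set V)
    (ρ : V → ℝ) : V → ℝ :=
  Classical.epsilon (IsScore α E T R ρ)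

/-! With a common trust value `t ∈ [0, 1]`, the scores exist and are unique. -/

section WellDefined

variable [Fintype V]

open scoped Classical in
/-- The coefficient of `s j` in `weightedMean`, for a common trust value `t`. -/
noncomputable def coeff (α t : ℝ) (E : Set (V × V)) (R : Set V) (i j : V) : ℝ :=
  (if (i, j) ∈ E then (if j ∈ R then α else 1 - α) * t ^ 2 else 0) /
    (α * ∑ _j ∈ raterNbrs E R i, t + (1 - α) * ∑ _j ∈ nonRaterNbrs E R i, t)

lemma sum_split (α : ℝ) (E : Set (V × V)) (R : Set V) (i : V) (f : V → ℝ) :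
    α * ∑ j ∈ raterNbrs E R i, f j + (1 - α) * ∑ j ∈ nonRaterNbrs E R i, f j =
      open scoped Classical in
      ∑ j, if (i, j) ∈ E then (if j ∈ R then α else 1 - α) * f j else 0 := by
  classical
  simp only [raterNbrs, nonRaterNbrs, Finset.sum_filter, Finset.mul_sum, ← Finset.sum_add_distrib]
  refine Finset.sum_congr rfl fun j _ => ?_
  by_cases h1 : (i, j) ∈ E <;> by_cases h2 : j ∈ R <;> simp [h1, h2]

lemma weightedMean_eq (α t : ℝ) (E : Set (V × V)) (R : Set V) (s : V → ℝ) (i : V) :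
    weightedMean α E (fun _ _ => t) R s i = ∑ j, coeff α t E R i j * s j := by
  classical
  simp only [weightedMean, coeff]
  rw [sum_split α E R i (fun j => t ^ 2 * s j), Finset.sum_div]
  refine Finset.sum_congr rfl fun j _ => ?_
  split_ifs <;> ring

lemma coeff_nonneg {α t : ℝ} (hα0 : 0 < α) (hα1 : α < 1) (ht0 : 0 ≤ t)
    (E : Set (V × V)) (R : Set V) (i j : V) : 0 ≤ coeff α t E R i j := by
  have : 0 ≤ 1 - α := by linarith
  unfold coeff
  split_ifs <;> positivity

lemma coeff_pos {α t : ℝ} (hα0 : 0 < α) (hα1 : α < 1) (ht0 : 0 ≤ t)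
    (E : Set (V × V)) (R : Set V) (i j : V) (ht : t ≠ 0) (h : (i, j) ∈ E) :
    0 < coeff α t E R i j := by
  classical
  have h1 : 0 < 1 - α := by linarith
  have h2 : 0 < t := lt_of_le_of_ne ht0 (Ne.symm ht)
  have hc : ∀ k, 0 < (if k ∈ R then α else 1 - α) := fun k => by split_ifs <;> assumption
  unfold coeff
  rw [sum_split α E R i (fun _ => t), if_pos h]
  refine div_pos (mul_pos (hc j) (by positivity)) ?_
  refine Finset.sum_pos' (fun k _ => ?_) ⟨j, Finset.mem_univ _, ?_⟩
  · have := hc k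
    split_ifs <;> positivity
  · rw [if_pos h]
    exact mul_pos (hc j) h2

lemma sum_coeff_le {α t : ℝ} (ht1 : t ≤ 1)
    (E : Set (V × V)) (R : Set V) (i : V) :
    ∑ j, coeff α t E R i j ≤ 1 := by
  classical
  unfold coeff
  rw [← Finset.sum_div, ← sum_split α E R i (fun _ => t ^ 2)]
  have : α * ∑ _j ∈ raterNbrs E R i, t ^ 2 + (1 - α) * ∑ _j ∈ nonRaterNbrs E R i, t ^ 2 =
      t * (α * ∑ _j ∈ raterNbrs E R i, t + (1 - α) * ∑ _j ∈ nonRaterNbrs E R i, t) := by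
    simp only [Finset.sum_const, nsmul_eq_mul]
    ring
  rw [this, mul_div_assoc]
  exact mul_le_one₀ ht1 (by
    rcases eq_or_ne (α * ∑ _j ∈ raterNbrs E R i, t + (1 - α) * ∑ _j ∈ nonRaterNbrs E R i, t) 0
      with h | h
    · rw [h, div_zero]
    · rw [div_self h]; norm_num) (div_self_le_one _)

lemma le_zero_of_fixed {α t : ℝ} (hα0 : 0 < α) (hα1 : α < 1) (ht0 : 0 ≤ t) (ht1 : t ≤ 1)
    (E : Set (V × V)) (R : Set V) (s : V → ℝ)
    (h1 : ∀ i, i ∈ R ∨ ¬ TrustsSomeRater E R i → s i = 0)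
    (h2 : ∀ i, ¬ (i ∈ R ∨ ¬ TrustsSomeRater E R i) → s i = ∑ j, coeff α t E R i j * s j) (i : V) :
    s i ≤ 0 := by
  classical
  by_contra! hi
  obtain ⟨m, -, hm⟩ := Finset.exists_max_image Finset.univ s ⟨i, Finset.mem_univ i⟩
  have hM : 0 < s m := hi.trans_le (hm i (Finset.mem_univ i))
  have good : ∀ a, s a = s m → ¬ (a ∈ R ∨ ¬ TrustsSomeRater E R a) := fun a ha hc => by
    have := h1 a hc
    linarith
  have htne : t ≠ 0 := by
    rintro rfl
    have := h2 m (good m rfl)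
    simp [coeff] at this
    linarith
  have step : ∀ a b, s a = s m → (a, b) ∈ E → s b = s m := by
    intro a b ha hab
    by_contra hne
    have hlt : s b < s m := lt_of_le_of_ne (hm b (Finset.mem_univ b)) hne
    have h3 := h2 a (good a ha)
    have h4 : ∑ j, coeff α t E R a j * s j < ∑ j, coeff α t E R a j * s m := by
      refine Finset.sum_lt_sum (fun j _ => ?_) ⟨b, Finset.mem_univ b, ?_⟩
      · exact mul_le_mul_of_nonneg_left (hm j (Finset.mem_univ j))
          (coeff_nonneg hα0 hα1 ht0 E R a j)
      · exact mul_lt_mul_of_pos_left hlt (coeff_pos hα0 hα1 ht0 E R a b htne hab)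
    rw [← Finset.sum_mul] at h4
    have h5 := mul_le_mul_of_nonneg_right (sum_coeff_le (α := α) ht1 E R a) hM.le
    linarith
  have hmt := good m rfl
  push Not at hmt
  obtain ⟨j, hj, hpath⟩ := hmt.2
  have hsj : s j = s m := by
    clear hj
    induction hpath with
    | single h => exact step _ _ rfl h
    | tail _ h ih => exact step _ _ ih h
  exact good j hsj (Or.inl hj)

/-- With a common trust value in `[0, 1]` and a rater weight in `(0, 1)`, there is exactly one
vector of satisfaction scores. -/
theorem existsUnique_isScore {α t : ℝ} (hα0 : 0 < α) (hα1 : α < 1) (ht0 : 0 ≤ t) (ht1 : t ≤ 1)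
    (E : Set (V × V)) (R : Set V) (ρ : V → ℝ) :
    ∃! s, IsScore α E (fun _ _ => t) R ρ s := by
  classical
  let P : V → Prop := fun i => i ∈ R ∨ ¬ TrustsSomeRater E R i
  let L : (V → ℝ) →ₗ[ℝ] (V → ℝ) :=
    { toFun := fun s i => if P i then s i else s i - ∑ j, coeff α t E R i j * s j
      map_add' := fun x y => by
        funext i
        by_cases h : P i
        · simp [h]
        · simp only [h, if_false, Pi.add_apply, mul_add, Finset.sum_add_distrib]
          ring
      map_smul' := fun c x => by
        funext i
        by_cases h : P i
        · simp [h]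
        · simp only [h, if_false, Pi.smul_apply, smul_eq_mul, RingHom.id_apply, mul_sub,
            Finset.mul_sum]
          congr 1
          exact Finset.sum_congr rfl fun j _ => by ring }
  have hL : ∀ s i, L s i = if P i then s i else s i - ∑ j, coeff α t E R i j * s j :=
    fun _ _ => rfl
  have hle : ∀ s, L s = 0 → ∀ i, s i ≤ 0 := by
    intro s hs i
    refine le_zero_of_fixed hα0 hα1 ht0 ht1 E R s (fun i hi => ?_) (fun i hi => ?_) i
    · have := congrFun hs i
      rw [hL, if_pos hi] at this
      exact this
    · have := congrFun hs i
      rw [hL, if_neg hi] at this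
      exact sub_eq_zero.1 this
  have hinj : Function.Injective L := by
    refine (injective_iff_map_eq_zero L).2 fun s hs => ?_
    funext i
    have h1 := hle s hs i
    have h2 := hle (-s) (by rw [map_neg, hs, neg_zero]) i
    simp only [Pi.neg_apply, Pi.zero_apply] at h2 ⊢
    linarith
  have hsurj : Function.Surjective L := LinearMap.injective_iff_surjective.1 hinj
  let b : V → ℝ := fun i => if i ∈ R then ρ i else 0
  have key : ∀ s, IsScore α E (fun _ _ => t) R ρ s ↔ L s = b := by
    intro s
    constructor
    · intro h
      funext i
      rw [hL]
      by_cases hi : i ∈ R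
      · simp [P, b, hi, h.rater i hi]
      · by_cases hp : TrustsSomeRater E R i
        · have := h.nonRater i hi
          rw [weightedMean_eq] at this
          simp only [P, b, hi, hp, not_true_eq_false, or_self, if_false]
          linarith
        · simp [P, b, hi, hp, h.noTrust i hi hp]
    · intro h
      have h0 : ∀ i ∉ R, ¬ TrustsSomeRater E R i → s i = 0 := fun i hi hp => by
        have := congrFun h i
        rw [hL] at this
        simpa [P, b, hi, hp] using this
      refine ⟨fun i hi => ?_, fun i hi => ?_, h0⟩
      · have := congrFun h i
        rw [hL] at this
        simpa [P, b, hi] using this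
      · rw [weightedMean_eq]
        by_cases hp : TrustsSomeRater E R i
        · have := congrFun h i
          rw [hL] at this
          simp only [P, b, hi, hp, not_true_eq_false, or_self, if_false] at this
          linarith
        · rw [h0 i hi hp]
          symm
          refine Finset.sum_eq_zero fun j _ => ?_
          by_cases hE : (i, j) ∈ E
          · have hjR : j ∉ R := fun hj => hp ⟨j, hj, .single hE⟩
            have hjp : ¬ TrustsSomeRater E R j := fun ⟨k, hk, hjk⟩ => hp ⟨k, hk, .head hE hjk⟩
            rw [h0 j hjR hjp, mul_zero]
          · simp [coeff, hE]
  obtain ⟨s, hs⟩ := hsurj b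
  exact ⟨s, (key s).2 hs, fun s' hs' => hinj (((key s').1 hs').trans hs.symm)⟩

/-- `score` is the vector of satisfaction scores. -/
theorem isScore_score {α t : ℝ} (hα0 : 0 < α) (hα1 : α < 1) (ht0 : 0 ≤ t) (ht1 : t ≤ 1)
    (E : Set (V × V)) (R : Set V) (ρ : V → ℝ) :
    IsScore α E (fun _ _ => t) R ρ (score α E (fun _ _ => t) R ρ) :=
  Classical.epsilon_spec (existsUnique_isScore hα0 hα1 ht0 ht1 E R ρ).exists

end WellDefined

end Scores

/-- The law of the directed Erdős–Rényi graph `G(N, λ / N)` on `Fin N`, as a random set of edges: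
each of the `N (N - 1)` pairs `(i, j)` with `i ≠ j` is an edge with probability `λ / N`,
independently. (`Set.projIcc` truncates `λ / N` to `[0, 1]`; this matters only for `N < λ`.) -/
noncomputable def erdosRenyi (lam : ℝ) (N : ℕ) : Measure (Set (Fin N × Fin N)) :=
  setBernoulli {e | e.1 ≠ e.2} (Set.projIcc (0 : ℝ) 1 zero_le_one (lam / N))

/-- The law of a uniformly random set of exactly `m` raters among `N` users. -/
noncomputable def uniformRaters (N m : ℕ) : Measure (Set (Fin N)) :=
  uniformOn {R | R.ncard = m}

/-- The joint law of the trust graph and of the set of `m` raters, which are independent. -/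
noncomputable def networkLaw (lam : ℝ) (N m : ℕ) : Measure (Set (Fin N × Fin N) × Set (Fin N)) :=
  (erdosRenyi lam N).prod (uniformRaters N m)

/-- The satisfaction score of user `i` in the realization `ω = (E, R)`, with common trust `t`,
common rating `r` and equal weights `α = 1 / 2` for raters and non-raters. -/
noncomputable def userScore (t r : ℝ) {N : ℕ} (ω : Set (Fin N × Fin N) × Set (Fin N))
    (i : Fin N) : ℝ :=
  score (1 / 2) ω.1 (fun _ _ => t) ω.2 (fun _ => r) i

open scoped Classical in
/-- The mean score of a non-rater chosen uniformly at random in the realization `ω = (E, R)`. -/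
noncomputable def nonRaterMean (t r : ℝ) {N : ℕ} (ω : Set (Fin N × Fin N) × Set (Fin N)) : ℝ :=
  (∑ i with i ∉ ω.2, userScore t r ω i) / (ω.2ᶜ.ncard : ℝ)

end TrustNetwork

/-!
The score of a user is the expected payoff of a random walk along the trust edges that survives
each step with probability `t`, pays `r` on hitting a rater and nothing if it never does. Its
expectation is squeezed between the expectations of two walks that are easier to average:
`truncScore` stops after `n` steps, or on meeting a vertex seen before, with a payoff `c`. The
Bellman equation for the score and the bounds `0 ≤ s ≤ r`, which come from a maximum principle,
give a lower bound for `c = 0` and an upper bound for `c = r` (`truncScore_le_score`,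
`score_le_truncScore`), for each graph and each set of raters.

The stopped walk inspects the out-edges of each vertex at most once. So, for a *fixed* set of
raters, the row of the current vertex is independent of the continuation, and by exchangeability
each other vertex is the next one with the same probability `(1 - (1 - p) ^ (N - 1)) / (N - 1)`,
where `p = λ / N`. Hence the expectation obeys an exact scalar recursion in `n` and the number of
vertices seen (`integral_truncScore`). As `N → ∞`, with `Q = 1 - exp (-λ)`, the recursion
becomes the iteration of `x ↦ t * Q * (k * r + (1 - k) * x)`, a contraction because `Q < 1`
(also for `t = 1` and `k = 0`), whose fixed point is the claimed limit. Letting `n → ∞` after `N`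
removes the dependence on `c`. The estimate is uniform in the set of raters and in the non-rater,
so it survives averaging over the raters, whether conditioned or not.
-/

namespace TrustNetwork

/-! ### The score as a fixed point of the random walk on the trust graph -/

section Deterministic

variable {V : Type*}

open scoped Classical in
/-- The probability that the simple random walk on the graph `E`, killed at the vertices without
out-edges, steps from `i` to `j`. A loop at `i` counts as an out-edge. -/
noncomputable def stepProb (E : Set (V × V)) (i j : V) : ℝ :=
  if (i, j) ∈ E then ({l | (i, l) ∈ E}.ncard : ℝ)⁻¹ else 0

lemma stepProb_nonneg (E : Set (V × V)) (i j : V) : 0 ≤ stepProb E i j := by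
  unfold stepProb
  split_ifs <;> positivity

lemma stepProb_congr {E E' : Set (V × V)} {i : V} (h : ∀ l, (i, l) ∈ E ↔ (i, l) ∈ E') (j : V) :
    stepProb E i j = stepProb E' i j := by
  by_cases hj : (i, j) ∈ E <;> simp [stepProb, ← h, hj]

open scoped Classical in
lemma sum_stepProb [Fintype V] (E : Set (V × V)) (i : V) :
    ∑ j, stepProb E i j = if ∀ l, (i, l) ∉ E then 0 else 1 := by
  simp only [stepProb]
  rw [← Finset.sum_filter, Finset.sum_const, nsmul_eq_mul]
  have hc : (Finset.univ.filter fun l => (i, l) ∈ E).card = {l | (i, l) ∈ E}.ncard := by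
    rw [← Set.ncard_coe_finset]
    congr 1
    ext
    simp
  rw [hc]
  split_ifs with h
  · have : {l | (i, l) ∈ E} = ∅ := by
      ext l
      simp [h l]
    simp [this]
  · push Not at h
    refine mul_inv_cancel₀ ?_
    rw [Nat.cast_ne_zero]
    exact ((Set.ncard_pos (Set.toFinite _)).2 h).ne'

/-- With equal weights, the score equation is the Bellman equation of the random walk that
survives each step with probability `t`. -/
lemma coeff_half [Fintype V] (t : ℝ) (E : Set (V × V)) (R : Set V) (i j : V) :
    coeff (1 / 2) t E R i j = t * stepProb E i j := by
  classical
  have hden : (1 / 2 : ℝ) * ∑ _j ∈ raterNbrs E R i, t + (1 - 1 / 2) * ∑ _j ∈ nonRaterNbrs E R i, t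
      = 1 / 2 * t * {l | (i, l) ∈ E}.ncard := by
    rw [sum_split (1 / 2) E R i (fun _ => t)]
    have : ∀ j, (if (i, j) ∈ E then (if j ∈ R then (1 / 2 : ℝ) else 1 - 1 / 2) * t else 0) =
        if (i, j) ∈ E then 1 / 2 * t else 0 := fun j => by
      split_ifs <;> ring
    simp only [this]
    rw [← Finset.sum_filter, Finset.sum_const, nsmul_eq_mul, mul_comm, ← Set.ncard_coe_finset]
    congr 3
    ext
    simp
  unfold coeff stepProb
  rw [hden]
  by_cases h : (i, j) ∈ E
  · rw [if_pos h, if_pos h]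
    rcases eq_or_ne t 0 with rfl | ht
    · simp
    have hn : ({l | (i, l) ∈ E}.ncard : ℝ) ≠ 0 :=
      Nat.cast_ne_zero.2 ((Set.ncard_pos (Set.toFinite _)).2 ⟨j, h⟩).ne'
    have : (if j ∈ R then (1 / 2 : ℝ) else 1 - 1 / 2) = 1 / 2 := by split_ifs <;> norm_num
    rw [this]
    field_simp
  · simp [h]

/-- Maximum principle: a subsolution of the score equation that is nonpositive on the raters and
on the users who trust no rater is nonpositive. -/
lemma nonpos_of_subsolution [Fintype V] {α t : ℝ} (hα0 : 0 < α) (hα1 : α < 1) (ht0 : 0 ≤ t)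
    (ht1 : t ≤ 1) (E : Set (V × V)) (R : Set V) (s : V → ℝ)
    (h1 : ∀ i, i ∈ R ∨ ¬ TrustsSomeRater E R i → s i ≤ 0)
    (h2 : ∀ i, ¬ (i ∈ R ∨ ¬ TrustsSomeRater E R i) → s i ≤ ∑ j, coeff α t E R i j * s j) (i : V) :
    s i ≤ 0 := by
  classical
  by_contra! hi
  obtain ⟨m, -, hm⟩ := Finset.exists_max_image Finset.univ s ⟨i, Finset.mem_univ i⟩
  have hM : 0 < s m := hi.trans_le (hm i (Finset.mem_univ i))
  have good : ∀ a, s a = s m → ¬ (a ∈ R ∨ ¬ TrustsSomeRater E R a) := fun a ha hc => by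
    have := h1 a hc
    linarith
  have htne : t ≠ 0 := by
    rintro rfl
    have := h2 m (good m rfl)
    simp [coeff] at this
    linarith
  -- the maximum propagates along the edges, hence up to a rater
  have step : ∀ a b, s a = s m → (a, b) ∈ E → s b = s m := by
    intro a b ha hab
    by_contra hne
    have hlt : s b < s m := lt_of_le_of_ne (hm b (Finset.mem_univ b)) hne
    have h3 := h2 a (good a ha)
    have h4 : ∑ j, coeff α t E R a j * s j < ∑ j, coeff α t E R a j * s m := by
      refine Finset.sum_lt_sum (fun j _ => ?_) ⟨b, Finset.mem_univ b, ?_⟩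
      · exact mul_le_mul_of_nonneg_left (hm j (Finset.mem_univ j))
          (coeff_nonneg hα0 hα1 ht0 E R a j)
      · exact mul_lt_mul_of_pos_left hlt (coeff_pos hα0 hα1 ht0 E R a b htne hab)
    rw [← Finset.sum_mul] at h4
    have h5 := mul_le_mul_of_nonneg_right (sum_coeff_le (α := α) ht1 E R a) hM.le
    linarith
  have hmt := good m rfl
  push Not at hmt
  obtain ⟨j, hj, hpath⟩ := hmt.2
  have hsj : s j = s m := by
    clear hj
    induction hpath with
    | single h => exact step _ _ rfl h
    | tail _ h ih => exact step _ _ ih h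
  exact good j hsj (Or.inl hj)

lemma score_nonneg [Fintype V] {t r : ℝ} (ht0 : 0 ≤ t) (ht1 : t ≤ 1) (E : Set (V × V))
    (R : Set V) (hr0 : 0 ≤ r) (i : V) :
    0 ≤ score (1 / 2) E (fun _ _ => t) R (fun _ => r) i := by
  have hs := isScore_score (α := 1 / 2) (by norm_num) (by norm_num) ht0 ht1 E R (fun _ => r)
  set s := score (1 / 2) E (fun _ _ => t) R (fun _ => r)
  have := nonpos_of_subsolution (α := 1 / 2) (by norm_num) (by norm_num) ht0 ht1 E R
    (fun i => - s i) (fun i hi => ?_) (fun i hi => ?_) i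
  · simpa using this
  · by_cases hR : i ∈ R
    · simp [hs.rater i hR, hr0]
    · simp [hs.noTrust i hR (by tauto)]
  · rw [hs.nonRater i (by tauto), weightedMean_eq]
    simp

lemma score_le [Fintype V] {t r : ℝ} (ht0 : 0 ≤ t) (ht1 : t ≤ 1) (E : Set (V × V))
    (R : Set V) (hr0 : 0 ≤ r) (i : V) :
    score (1 / 2) E (fun _ _ => t) R (fun _ => r) i ≤ r := by
  have hs := isScore_score (α := 1 / 2) (by norm_num) (by norm_num) ht0 ht1 E R (fun _ => r)
  set s := score (1 / 2) E (fun _ _ => t) R (fun _ => r)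
  have := nonpos_of_subsolution (α := 1 / 2) (by norm_num) (by norm_num) ht0 ht1 E R
    (fun i => s i - r) (fun i hi => ?_) (fun i hi => ?_) i
  · simpa using this
  · by_cases hR : i ∈ R
    · simp [hs.rater i hR]
    · simp [hs.noTrust i hR (by tauto), hr0]
  · rw [hs.nonRater i (by tauto), weightedMean_eq]
    simp only [mul_sub, Finset.sum_sub_distrib, ← Finset.sum_mul]
    have := mul_le_mul_of_nonneg_right (sum_coeff_le (α := 1 / 2) ht1 E R i) hr0
    linarith

lemma score_eq_sum [Fintype V] {t r : ℝ} (ht0 : 0 ≤ t) (ht1 : t ≤ 1) (E : Set (V × V))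
    (R : Set V) {i : V} (hi : i ∉ R) :
    score (1 / 2) E (fun _ _ => t) R (fun _ => r) i =
      t * ∑ j, stepProb E i j * score (1 / 2) E (fun _ _ => t) R (fun _ => r) j := by
  have hs := isScore_score (α := 1 / 2) (by norm_num) (by norm_num) ht0 ht1 E R (fun _ => r)
  rw [hs.nonRater i hi, weightedMean_eq, Finset.mul_sum]
  exact Finset.sum_congr rfl fun j _ => by rw [coeff_half, mul_assoc]

open scoped Classical in
/-- The expected payoff of the walk started at `i` that survives each step with probability `t`,
pays `r` when it hits a rater, and is stopped with payoff `c` after `n` steps or as soon as it hits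
`A` or a vertex that it has already visited. Every row of `E` is then inspected at most once. -/
noncomputable def truncScore [Fintype V] (t r c : ℝ) (E : Set (V × V)) (R : Set V) :
    ℕ → Set V → V → ℝ
  | 0, _, _ => c
  | n + 1, A, i => t * ∑ j, stepProb E i j *
      if j ∈ R then r else if j ∈ insert i A then c else truncScore t r c E R n (insert i A) j

/-- `truncScore` started outside `A` does not inspect the out-edges of `A`. -/
lemma truncScore_congr [Fintype V] {t r c : ℝ} {E E' : Set (V × V)} {R : Set V} (n : ℕ) :
    ∀ (A : Set V) (i : V), i ∉ A → (∀ a ∉ A, ∀ b, (a, b) ∈ E ↔ (a, b) ∈ E') →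
      truncScore t r c E R n A i = truncScore t r c E' R n A i := by
  induction n with
  | zero => intros; rfl
  | succ n ih =>
    intro A i hi h
    simp only [truncScore]
    congr 1
    refine Finset.sum_congr rfl fun j _ => ?_
    rw [stepProb_congr (h i hi)]
    congr 1
    by_cases hA : j ∈ insert i A
    · simp [hA]
    · rw [ih _ j hA fun a ha => h a fun h' => ha (Set.mem_insert_of_mem _ h')]

lemma truncScore_le_score [Fintype V] {t r : ℝ} (ht0 : 0 ≤ t) (ht1 : t ≤ 1) (hr0 : 0 ≤ r)
    (E : Set (V × V)) (R : Set V) (n : ℕ) : ∀ (A : Set V) (i : V), i ∉ R →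
      truncScore t r 0 E R n A i ≤ score (1 / 2) E (fun _ _ => t) R (fun _ => r) i := by
  have hs := isScore_score (α := 1 / 2) (by norm_num) (by norm_num) ht0 ht1 E R (fun _ => r)
  induction n with
  | zero => exact fun A i _ => score_nonneg ht0 ht1 E R hr0 i
  | succ n ih =>
    intro A i hi
    rw [score_eq_sum ht0 ht1 E R hi, truncScore]
    refine mul_le_mul_of_nonneg_left (Finset.sum_le_sum fun j _ =>
      mul_le_mul_of_nonneg_left ?_ (stepProb_nonneg E i j)) ht0
    split_ifs with h1 h2
    · exact (hs.rater j h1).ge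
    · exact score_nonneg ht0 ht1 E R hr0 j
    · exact ih _ j h1

lemma score_le_truncScore [Fintype V] {t r : ℝ} (ht0 : 0 ≤ t) (ht1 : t ≤ 1) (hr0 : 0 ≤ r)
    (E : Set (V × V)) (R : Set V) (n : ℕ) : ∀ (A : Set V) (i : V), i ∉ R →
      score (1 / 2) E (fun _ _ => t) R (fun _ => r) i ≤ truncScore t r r E R n A i := by
  have hs := isScore_score (α := 1 / 2) (by norm_num) (by norm_num) ht0 ht1 E R (fun _ => r)
  induction n with
  | zero => exact fun A i _ => score_le ht0 ht1 E R hr0 i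
  | succ n ih =>
    intro A i hi
    rw [score_eq_sum ht0 ht1 E R hi, truncScore]
    refine mul_le_mul_of_nonneg_left (Finset.sum_le_sum fun j _ =>
      mul_le_mul_of_nonneg_left ?_ (stepProb_nonneg E i j)) ht0
    split_ifs with h1 h2
    · exact (hs.rater j h1).le
    · exact score_le ht0 ht1 E R hr0 j
    · exact ih _ j h1

end Deterministic

/-! ### Independence and exchangeability for Bernoulli random sets -/

section SetBernoulli

variable {ι : Type*} [Finite ι] (u : Set ι) (p : unitInterval)

/-- The traces of a Bernoulli random set on `A` and on its complement are independent. -/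
lemma integral_mul_setBernoulli (A : Set ι) (f g : Set ι → ℝ)
    (hf : ∀ s s' : Set ι, (∀ a ∈ A, a ∈ s ↔ a ∈ s') → f s = f s')
    (hg : ∀ s s' : Set ι, (∀ a ∉ A, a ∈ s ↔ a ∈ s') → g s = g s') :
    ∫ s, f s * g s ∂(setBernoulli u p) =
      (∫ s, f s ∂(setBernoulli u p)) * ∫ s, g s ∂(setBernoulli u p) := by
  classical
  cases nonempty_fintype ι
  have hm : Measurable (fun q : ι → Prop => {i | q i}) := .of_discrete
  rw [setBernoulli_eq_map, integral_map hm.aemeasurable .of_discrete,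
    integral_map hm.aemeasurable .of_discrete, integral_map hm.aemeasurable .of_discrete]
  set P := Measure.infinitePi fun i : ι =>
    unitInterval.toNNReal p • Measure.dirac (i ∈ u) +
      unitInterval.toNNReal (unitInterval.symm p) • Measure.dirac False
  have hI : iIndepFun (fun (i : ι) (q : ι → Prop) => q i) P :=
    iIndepFun_infinitePi (X := fun _ x => x) fun _ => measurable_id
  let S : Finset ι := A.toFinset
  have h1 := hI.indepFun_finset S Sᶜ disjoint_compl_right fun i => measurable_pi_apply i
  let F (T : Finset ι) (h : Set ι → ℝ) (x : T → Prop) : ℝ := h {i | ∃ hi : i ∈ T, x ⟨i, hi⟩}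
  have h2 := h1.comp (φ := F S f) (ψ := F Sᶜ g) .of_discrete .of_discrete
  have hF : (F S f ∘ fun (q : ι → Prop) (i : S) => q i) = fun q => f {i | q i} := by
    funext q
    exact hf _ _ fun a ha => by simp [S, ha]
  have hG : (F Sᶜ g ∘ fun (q : ι → Prop) (i : (Sᶜ : Finset ι)) => q i) =
      fun q => g {i | q i} := by
    funext q
    exact hg _ _ fun a ha => by simp [S, ha]
  rw [hF, hG] at h2
  exact h2.integral_fun_mul_eq_mul_integral .of_discrete .of_discrete

/-- The law of a Bernoulli random subset of `u` is invariant under the permutations that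
preserve `u`. -/
lemma integral_setBernoulli_image (σ : Equiv.Perm ι) (hσ : ∀ i, σ i ∈ u ↔ i ∈ u)
    (f : Set ι → ℝ) :
    ∫ s, f (σ '' s) ∂(setBernoulli u p) = ∫ s, f s ∂(setBernoulli u p) := by
  classical
  cases nonempty_fintype ι
  rw [integral_fintype .of_finite, integral_fintype .of_finite]
  refine Fintype.sum_equiv (Equiv.Set.congr σ) _ _ fun s => ?_
  have himg : Equiv.Set.congr σ s = σ '' s := rfl
  have hu : σ '' u = u := by
    ext i
    rw [Set.mem_image_equiv, ← hσ, Equiv.apply_symm_apply]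
  have hsub : σ '' s ⊆ u ↔ s ⊆ u := by
    rw [Set.image_subset_iff]
    exact forall_congr' fun i => by simp [hσ]
  rw [himg]
  congr 1
  by_cases hs : s ⊆ u
  · rw [setBernoulli_real_singleton p hs u.toFinite,
      setBernoulli_real_singleton p (hsub.2 hs) u.toFinite,
      Set.ncard_image_of_injective _ σ.injective]
    congr 2
    conv_rhs => rw [← hu, ← Set.image_sdiff σ.injective, Set.ncard_image_of_injective _ σ.injective]
  · simp [measureReal_def, setBernoulli_singleton_of_not_subset p hs,
      setBernoulli_singleton_of_not_subset p (mt hsub.1 hs)]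

end SetBernoulli

/-! ### Expected transition probabilities -/

section Rows

variable {V : Type*} [Fintype V] (p : unitInterval)

lemma setBernoulli_real_no_outEdge (i : V) :
    (setBernoulli {e : V × V | e.1 ≠ e.2} p).real {E | ∀ l, (i, l) ∉ E} =
      (1 - (p : ℝ)) ^ (Fintype.card V - 1) := by
  classical
  have hset : (fun q : V × V → Prop => {e | q e}) ⁻¹' {E | ∀ l, (i, l) ∉ E} =
      ((Finset.univ.image fun l => (i, l) : Finset (V × V)) : Set (V × V)).pi
        fun _ => {False} := by
    ext q
    simp [Set.mem_pi]
  have hfac : ∀ l : V, (unitInterval.toNNReal p • Measure.dirac ((i, l) ∈ {e : V × V | e.1 ≠ e.2}) +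
      unitInterval.toNNReal (unitInterval.symm p) • Measure.dirac False : Measure Prop) {False} =
        if l = i then 1 else (unitInterval.toNNReal (unitInterval.symm p) : ENNReal) := by
    intro l
    by_cases h : l = i
    · subst h
      simp [← ENNReal.coe_add]
    · simp [h, Ne.symm h]
  rw [measureReal_def, setBernoulli_apply', hset, Measure.infinitePi_pi _ (by simp),
    Finset.prod_image (Prod.mk_right_injective i).injOn]
  simp only [hfac]
  rw [Finset.prod_ite, Finset.prod_const_one, one_mul, Finset.prod_const,
    Finset.filter_ne', Finset.card_erase_of_mem (Finset.mem_univ i), Finset.card_univ]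
  simp

lemma integral_stepProb_self (i : V) :
    ∫ E, stepProb E i i ∂(setBernoulli {e : V × V | e.1 ≠ e.2} p) = 0 := by
  refine integral_eq_zero_of_ae ?_
  filter_upwards [setBernoulli_ae_subset (u := {e : V × V | e.1 ≠ e.2}) (p := p)] with E hE
  have : (i, i) ∉ E := fun h => hE h rfl
  simp [stepProb, this]

/-- The expected probability of a step to a given vertex `j ≠ i`: the walk has somewhere to go with
probability `1 - (1 - p) ^ (N - 1)`, and the `N - 1` targets are exchangeable. -/
lemma integral_stepProb {i j : V} (hij : j ≠ i) :
    ∫ E, stepProb E i j ∂(setBernoulli {e : V × V | e.1 ≠ e.2} p) =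
      (1 - (1 - (p : ℝ)) ^ (Fintype.card V - 1)) / (Fintype.card V - 1) := by
  classical
  set μ := setBernoulli {e : V × V | e.1 ≠ e.2} p
  have hsymm : ∀ l ≠ i, ∫ E, stepProb E i l ∂μ = ∫ E, stepProb E i j ∂μ := by
    intro l hl
    rw [← integral_setBernoulli_image _ p (Equiv.swap (i, j) (i, l)) (fun e => ?_)]
    · refine integral_congr_ae (.of_forall fun E => ?_)
      have hmem : ∀ b, (i, b) ∈ Equiv.swap (i, j) (i, l) '' E ↔ (i, Equiv.swap j l b) ∈ E := by
        intro b
        rw [(Prod.mk_right_injective i).map_swap, Set.mem_image_equiv, Equiv.symm_swap]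
      have hcard : {b | (i, b) ∈ Equiv.swap (i, j) (i, l) '' E}.ncard = {b | (i, b) ∈ E}.ncard := by
        rw [← Set.ncard_image_of_injective _ (Equiv.swap j l).injective]
        congr 1
        ext b
        rw [Set.mem_image_equiv, Equiv.symm_swap]
        simp only [Set.mem_ofPred_eq, hmem, Equiv.swap_apply_self]
      simp only [stepProb, hcard]
      simp only [hmem, Equiv.swap_apply_right]
    · rw [Equiv.swap_apply_def]
      split_ifs with h1 h2
      · subst h1; simp [hij.symm, hl.symm]
      · subst h2; simp [hij.symm, hl.symm]
      · rfl
  have hsum : ∑ l, ∫ E, stepProb E i l ∂μ = 1 - (1 - (p : ℝ)) ^ (Fintype.card V - 1) := by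
    rw [← integral_finsetSum _ fun _ _ => .of_finite, ← setBernoulli_real_no_outEdge p i]
    have : ∀ E : Set (V × V), ∑ l, stepProb E i l =
        1 - Set.indicator {E | ∀ l, (i, l) ∉ E} 1 E := by
      intro E
      rw [sum_stepProb]
      by_cases h : ∀ l, (i, l) ∉ E <;> simp [Set.indicator, h]
    simp only [this]
    rw [integral_sub .of_finite .of_finite, integral_indicator_one .of_discrete]
    simp [μ]
  have hcard : (Finset.univ.erase i).card = Fintype.card V - 1 := by
    rw [Finset.card_erase_of_mem (Finset.mem_univ i), Finset.card_univ]
  have h1 : 1 < Fintype.card V := Fintype.one_lt_card_iff.2 ⟨j, i, hij⟩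
  have h2 : (1 : ℝ) < Fintype.card V := by exact_mod_cast h1
  rw [← Finset.add_sum_erase _ _ (Finset.mem_univ i), integral_stepProb_self, zero_add,
    Finset.sum_congr rfl fun l hl => hsymm l (Finset.ne_of_mem_erase hl), Finset.sum_const, hcard,
    nsmul_eq_mul, Nat.cast_sub h1.le, Nat.cast_one] at hsum
  rw [eq_div_iff (by linarith), mul_comm, hsum]

end Rows

/-! ### The expected truncated score -/

section Mean

/-- The expectation of `truncScore` over the random graph, for `m` raters among `N` users, when
`q` is the expected probability of a step to a given vertex and the set to avoid has `a`
elements. -/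
noncomputable def meanTruncScore (t r c q N m : ℝ) : ℕ → ℕ → ℝ
  | 0, _ => c
  | n + 1, a => t * (q * (m * r + a * c + (N - m - a - 1) * meanTruncScore t r c q N m n (a + 1)))

/-- The expectation depends on the raters and on the visited vertices only through their numbers:
the row of `i` is independent of the continuation of the walk, which does not inspect it. -/
lemma integral_truncScore {V : Type*} [Fintype V] (p : unitInterval) (t r c : ℝ) (R : Set V)
    (n : ℕ) : ∀ (A : Set V) (i : V), Disjoint A R → i ∉ A → i ∉ R →
      ∫ E, truncScore t r c E R n A i ∂(setBernoulli {e : V × V | e.1 ≠ e.2} p) =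
        meanTruncScore t r c
          ((1 - (1 - (p : ℝ)) ^ (Fintype.card V - 1)) / (Fintype.card V - 1))
          (Fintype.card V) R.ncard n A.ncard := by
  classical
  set μ := setBernoulli {e : V × V | e.1 ≠ e.2} p
  set q := (1 - (1 - (p : ℝ)) ^ (Fintype.card V - 1)) / (Fintype.card V - 1)
  induction n with
  | zero =>
    intro A i _ _ _
    simp [truncScore, meanTruncScore, μ]
  | succ n ih =>
    intro A i hAR hiA hiR
    simp only [truncScore, meanTruncScore]
    rw [integral_const_mul, integral_finsetSum _ fun _ _ => .of_finite]
    congr 1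
    have hins : (insert i A).ncard = A.ncard + 1 := Set.ncard_insert_of_notMem hiA (Set.toFinite _)
    set e := meanTruncScore t r c q (Fintype.card V) R.ncard n (A.ncard + 1)
    have hterm : ∀ j, ∫ E, (stepProb E i j * if j ∈ R then r else if j ∈ insert i A then c else
        truncScore t r c E R n (insert i A) j) ∂μ =
        q * (Set.indicator R 1 j * (r - e) + Set.indicator A 1 j * (c - e) + e -
          Set.indicator {i} 1 j * e) := by
      intro j
      rcases eq_or_ne j i with rfl | hji
      · simp only [hiR, if_false, Set.mem_insert_iff, true_or, if_true]
        rw [integral_mul_const, integral_stepProb_self]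
        simp [hiR, hiA]
      by_cases hjR : j ∈ R
      · have hjA : j ∉ A := fun h => Set.disjoint_left.1 hAR h hjR
        simp only [hjR, if_true]
        rw [integral_mul_const, integral_stepProb p hji]
        simp [hjR, hjA, hji, q]
      by_cases hjA : j ∈ A
      · simp only [hjR, if_false, Set.mem_insert_iff, hjA, or_true, if_true]
        rw [integral_mul_const, integral_stepProb p hji]
        simp [hjR, hjA, hji, q]
      have hj : j ∉ insert i A := by simp [hji, hjA]
      simp only [hjR, if_false, hj]
      rw [integral_mul_setBernoulli _ p {e | e.1 = i} (fun E => stepProb E i j)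
          (fun E => truncScore t r c E R n (insert i A) j), integral_stepProb p hji,
        ih (insert i A) j (by simp [Set.disjoint_insert_left, hiR, hAR]) hj hjR, hins]
      · simp [hjR, hjA, hji, q, e]
      · exact fun s s' h => stepProb_congr (fun l => h (i, l) rfl) j
      · exact fun s s' h => truncScore_congr n _ _ hj fun a ha b =>
          h (a, b) fun h' => ha (h' ▸ Set.mem_insert _ _)
    have hind : ∀ B : Set V, ∑ j, Set.indicator B (1 : V → ℝ) j = B.ncard := fun B => by
      simp [Set.indicator_apply, ← Set.ncard_coe_finset]
    simp only [hterm]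
    rw [← Finset.mul_sum, Finset.sum_sub_distrib, Finset.sum_add_distrib, Finset.sum_add_distrib,
      ← Finset.sum_mul, ← Finset.sum_mul, ← Finset.sum_mul, hind, hind, hind, Finset.sum_const,
      Finset.card_univ, Set.ncard_singleton, nsmul_eq_mul]
    push_cast
    ring

end Mean

/-! ### The limit of a large network -/

section Limit

/-- A user of `G(N, λ / N)` trusts somebody with a probability that tends to `1 - exp (-λ)`. -/
lemma tendsto_mul_expectedStep {lam : ℝ} (hlam : 0 ≤ lam) :
    Tendsto (fun N : ℕ => (N : ℝ) *
      ((1 - (1 - (Set.projIcc (0 : ℝ) 1 zero_le_one (lam / N) : ℝ)) ^ (N - 1)) / (N - 1)))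
      atTop (𝓝 (1 - Real.exp (-lam))) := by
  have h0 : Tendsto (fun N : ℕ => lam / N) atTop (𝓝 0) := tendsto_const_div_atTop_nhds_zero_nat lam
  have h1 : Tendsto (fun N : ℕ => (1 + -lam / N) ^ N / (1 - lam / N)) atTop
      (𝓝 (Real.exp (-lam) / (1 - 0))) :=
    (Real.tendsto_one_add_div_pow_exp (-lam)).div (tendsto_const_nhds.sub h0) (by norm_num)
  have h2 : Tendsto (fun N : ℕ => 1 / (1 - 1 / (N : ℝ))) atTop (𝓝 (1 / (1 - 0))) :=
    tendsto_const_nhds.div (tendsto_const_nhds.sub (tendsto_const_div_atTop_nhds_zero_nat 1))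
      (by norm_num)
  have h3 := h2.mul (tendsto_const_nhds (x := (1 : ℝ)).sub h1)
  simp only [sub_zero, div_one, one_mul] at h3
  refine h3.congr' ?_
  filter_upwards [h0.eventually_lt_const one_pos, eventually_gt_atTop 1] with N hN hN1
  have hp : (Set.projIcc (0 : ℝ) 1 zero_le_one (lam / N) : ℝ) = lam / N := by
    rw [Set.projIcc_of_mem _ ⟨by positivity, hN.le⟩]
  have hNr : (1 : ℝ) < N := by exact_mod_cast hN1
  have hpow : (1 + -lam / N) ^ N / (1 - lam / N) = (1 - lam / N) ^ (N - 1) := by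
    rw [neg_div, ← sub_eq_add_neg, ← pow_sub_one_mul (by omega : N ≠ 0),
      mul_div_cancel_right₀ _ (by linarith)]
  rw [hpow, hp]
  have : (N : ℝ) - 1 ≠ 0 := by linarith
  field_simp

/-- In the limit the walk meets only new vertices, each of them a rater with probability `k`, so
`n` steps apply `x ↦ t * Q * (k * r + (1 - k) * x)` to the stopping payoff `c` `n` times. -/
lemma tendsto_meanTruncScore {t r c k Q : ℝ} {q : ℕ → ℝ} {m : ℕ → ℕ}
    (hden : 1 - t * (1 - k) * Q ≠ 0)
    (hq : Tendsto (fun N : ℕ => (N : ℝ) * q N) atTop (𝓝 Q))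
    (hk : Tendsto (fun N : ℕ => (m N : ℝ) / N) atTop (𝓝 k)) (n : ℕ) : ∀ a : ℕ,
    Tendsto (fun N : ℕ => meanTruncScore t r c (q N) N (m N) n a) atTop
      (𝓝 (t * r * k * Q / (1 - t * (1 - k) * Q) +
        (t * (1 - k) * Q) ^ n * (c - t * r * k * Q / (1 - t * (1 - k) * Q)))) := by
  induction n with
  | zero =>
    intro a
    simpa only [meanTruncScore, pow_zero, one_mul, add_sub_cancel] using tendsto_const_nhds
  | succ n ih =>
    intro a
    have ha := tendsto_const_div_atTop_nhds_zero_nat (a * c)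
    have ha1 := tendsto_const_div_atTop_nhds_zero_nat ((a : ℝ) + 1)
    have h := (hq.mul (((hk.mul_const r).add ha).add
      (((tendsto_const_nhds (x := (1 : ℝ)).sub hk).sub ha1).mul (ih (a + 1))))).const_mul t
    have hlim : ∀ L : ℝ, L = t * r * k * Q / (1 - t * (1 - k) * Q) →
        t * (Q * (k * r + 0 + (1 - k - 0) * (L + (t * (1 - k) * Q) ^ n * (c - L)))) =
          L + (t * (1 - k) * Q) ^ (n + 1) * (c - L) := by
      intro L hL
      rw [eq_div_iff hden] at hL
      linear_combination -hL
    rw [hlim _ rfl] at h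
    refine h.congr' ?_
    filter_upwards [eventually_gt_atTop 0] with N hN
    have hN0 : (N : ℝ) ≠ 0 := by exact_mod_cast hN.ne'
    rw [meanTruncScore]
    field_simp
    ring

instance (lam : ℝ) (N : ℕ) : IsProbabilityMeasure (erdosRenyi lam N) := by
  unfold erdosRenyi
  infer_instance

/-- The expected score of a non-rater converges uniformly over the non-raters and over all
*deterministic* sets of `m N` raters. -/
lemma eventually_abs_integral_userScore_sub_lt {lam t r k : ℝ} (hlam : 0 ≤ lam) (ht0 : 0 ≤ t)
    (ht1 : t ≤ 1) (hr0 : 0 ≤ r) {m : ℕ → ℕ} (hm : ∀ᶠ N : ℕ in atTop, m N < N)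
    (hk : Tendsto (fun N : ℕ => (m N : ℝ) / N) atTop (𝓝 k)) {ε : ℝ} (hε : 0 < ε) :
    ∀ᶠ N : ℕ in atTop, ∀ R : Set (Fin N), R.ncard = m N → ∀ i ∉ R,
      |∫ E, userScore t r (E, R) i ∂(erdosRenyi lam N) -
        t * r * k * (1 - Real.exp (-lam)) / (1 - t * (1 - k) * (1 - Real.exp (-lam)))| < ε := by
  set Q := 1 - Real.exp (-lam)
  have hQ0 : 0 ≤ Q := sub_nonneg.2 (Real.exp_le_one_iff.2 (by linarith))
  have hQ1 : Q < 1 := sub_lt_self _ (Real.exp_pos _)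
  have hk0 : 0 ≤ k := ge_of_tendsto' hk fun N => by positivity
  have hk1 : k ≤ 1 := le_of_tendsto hk (hm.mono fun N h =>
    div_le_one_of_le₀ (by exact_mod_cast h.le) (by positivity))
  have htk0 : 0 ≤ t * (1 - k) := mul_nonneg ht0 (by linarith)
  have hβ0 : 0 ≤ t * (1 - k) * Q := mul_nonneg htk0 hQ0
  have hβ1 : t * (1 - k) * Q < 1 :=
    (mul_le_of_le_one_left hQ0 (mul_le_one₀ ht1 (by linarith) (by linarith))).trans_lt hQ1
  set L := t * r * k * Q / (1 - t * (1 - k) * Q) with hL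
  have hpow : ∀ c : ℝ, Tendsto (fun n : ℕ => L + (t * (1 - k) * Q) ^ n * (c - L)) atTop (𝓝 L) := by
    intro c
    simpa using ((tendsto_pow_atTop_nhds_zero_of_lt_one hβ0 hβ1).mul_const (c - L)).const_add L
  obtain ⟨n, hn0, hnr⟩ := (((hpow 0).eventually_const_lt (sub_lt_self L hε)).and
    ((hpow r).eventually_lt_const (lt_add_of_pos_right L hε))).exists
  have htend : ∀ c, _ := fun c => tendsto_meanTruncScore (r := r) (c := c) (sub_pos.2 hβ1).ne'
    (tendsto_mul_expectedStep hlam) hk n 0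
  filter_upwards [(htend 0).eventually_const_lt hn0, (htend r).eventually_lt_const hnr]
    with N h0 hr R hR i hi
  have hmean : ∀ c, ∫ E, truncScore t r c E R n ∅ i ∂(erdosRenyi lam N) = _ := fun c =>
    integral_truncScore (Set.projIcc (0 : ℝ) 1 zero_le_one (lam / N)) t r c R n ∅ i
      (Set.empty_disjoint R) (Set.notMem_empty i) hi
  simp only [Fintype.card_fin, Set.ncard_empty, hR] at hmean
  rw [← hmean] at h0 hr
  have hlo : ∫ E, truncScore t r 0 E R n ∅ i ∂(erdosRenyi lam N) ≤
      ∫ E, userScore t r (E, R) i ∂(erdosRenyi lam N) :=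
    integral_mono .of_finite .of_finite fun E => truncScore_le_score ht0 ht1 hr0 E R n ∅ i hi
  have hhi : ∫ E, userScore t r (E, R) i ∂(erdosRenyi lam N) ≤
      ∫ E, truncScore t r r E R n ∅ i ∂(erdosRenyi lam N) :=
    integral_mono .of_finite .of_finite fun E => score_le_truncScore ht0 ht1 hr0 E R n ∅ i hi
  rw [abs_lt]
  constructor <;> linarith

end Limit

/-! ### Averaging over the raters -/

section Raters

lemma exists_raters_of_lt {N m : ℕ} (h : m < N) (i : Fin N) :
    ∃ R : Set (Fin N), R.ncard = m ∧ i ∉ R := by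
  obtain ⟨S, hS, hc⟩ := Finset.exists_subset_card_eq (s := Finset.univ.erase i) (n := m) (by
    rw [Finset.card_erase_of_mem (Finset.mem_univ i), Finset.card_univ, Fintype.card_fin]
    omega)
  refine ⟨S, by rw [Set.ncard_coe_finset, hc], fun hi => ?_⟩
  exact Finset.notMem_erase i _ (hS hi)

lemma isProbabilityMeasure_uniformRaters {N m : ℕ} (h : m < N) :
    IsProbabilityMeasure (uniformRaters N m) := by
  obtain ⟨R, hR, -⟩ := exists_raters_of_lt h ⟨m, h⟩
  exact isProbabilityMeasure_uniformOn (Set.toFinite _) ⟨R, hR⟩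

lemma ae_uniformRaters_ncard (N m : ℕ) : ∀ᵐ R ∂(uniformRaters N m), R.ncard = m :=
  ae_cond_mem .of_discrete

lemma uniformRaters_real_notMem_pos {N m : ℕ} (h : m < N) (i : Fin N) :
    0 < (uniformRaters N m).real {R | i ∉ R} := by
  have := isProbabilityMeasure_uniformRaters h
  obtain ⟨R, hR, hi⟩ := exists_raters_of_lt h i
  refine ENNReal.toReal_pos (fun h0 => ?_) (measure_ne_top _ _)
  exact Set.eq_empty_iff_forall_notMem.1 ((uniformOn_eq_zero_iff (Set.toFinite _)).1 h0) R ⟨hR, hi⟩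

lemma abs_integral_nonRaterMean_sub_le {lam t r L δ : ℝ} {N m : ℕ}
    (hm : m < N) (h : ∀ R : Set (Fin N), R.ncard = m → ∀ i ∉ R,
      |∫ E, userScore t r (E, R) i ∂(erdosRenyi lam N) - L| ≤ δ) :
    |∫ ω, nonRaterMean t r ω ∂(networkLaw lam N m) - L| ≤ δ := by
  classical
  have := isProbabilityMeasure_uniformRaters hm
  rw [networkLaw, integral_prod_symm _ .of_finite]
  have hbound : ∀ᵐ R ∂(uniformRaters N m),
      ‖∫ E, nonRaterMean t r (E, R) ∂(erdosRenyi lam N) - L‖ ≤ δ := by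
    filter_upwards [ae_uniformRaters_ncard N m] with R hR
    have hcard : (Finset.univ.filter fun i => i ∉ R).card = Rᶜ.ncard := by
      rw [← Set.ncard_coe_finset]
      congr 1
      ext
      simp
    have hpos : (0 : ℝ) < Rᶜ.ncard := by
      rw [Nat.cast_pos, Set.ncard_compl, Nat.card_eq_fintype_card, Fintype.card_fin]
      omega
    have hmean : ∫ E, nonRaterMean t r (E, R) ∂(erdosRenyi lam N) - L =
        (∑ i with i ∉ R, (∫ E, userScore t r (E, R) i ∂(erdosRenyi lam N) - L)) / Rᶜ.ncard := by
      simp only [nonRaterMean]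
      rw [integral_div, integral_finsetSum _ fun _ _ => .of_finite, Finset.sum_sub_distrib,
        Finset.sum_const, hcard, nsmul_eq_mul, sub_div, mul_div_cancel_left₀ _ hpos.ne']
    rw [hmean, norm_div, Real.norm_natCast, div_le_iff₀ hpos]
    refine (norm_sum_le_of_le _ fun i hi => h R hR i (by simpa using hi)).trans_eq ?_
    rw [Finset.sum_const, hcard, nsmul_eq_mul, mul_comm]
  have h' := norm_integral_le_of_norm_le_const hbound
  rw [integral_sub .of_finite .of_finite] at h'
  simpa using h'

lemma abs_integral_cond_userScore_sub_le {lam t r L δ : ℝ} {N m : ℕ}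
    (hm : m < N) (h : ∀ R : Set (Fin N), R.ncard = m → ∀ i ∉ R,
      |∫ E, userScore t r (E, R) i ∂(erdosRenyi lam N) - L| ≤ δ) (i : Fin N) :
    |∫ ω, userScore t r ω i ∂(ProbabilityTheory.cond (networkLaw lam N m) {ω | i ∉ ω.2}) - L|
      ≤ δ := by
  have := isProbabilityMeasure_uniformRaters hm
  have hpos := uniformRaters_real_notMem_pos hm i
  have hreal : (networkLaw lam N m).real {ω | i ∉ ω.2} =
      (uniformRaters N m).real {R | i ∉ R} := by
    have : {ω : Set (Fin N × Fin N) × Set (Fin N) | i ∉ ω.2} = Set.univ ×ˢ {R | i ∉ R} := by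
      ext
      simp
    rw [networkLaw, this, measureReal_prod_prod, probReal_univ, one_mul]
  have hint : ∫ ω in {ω | i ∉ ω.2}, userScore t r ω i ∂(networkLaw lam N m) =
      ∫ R in {R | i ∉ R}, ∫ E, userScore t r (E, R) i ∂(erdosRenyi lam N)
        ∂(uniformRaters N m) := by
    rw [networkLaw, ← integral_indicator .of_discrete, ← integral_indicator .of_discrete,
      integral_prod_symm _ .of_finite]
    refine integral_congr_ae (.of_forall fun R => ?_)
    by_cases hi : i ∈ R <;> simp [Set.indicator, hi]
  have hbound : ‖∫ R in {R | i ∉ R}, (∫ E, userScore t r (E, R) i ∂(erdosRenyi lam N) - L)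
      ∂(uniformRaters N m)‖ ≤ δ * (uniformRaters N m).real {R | i ∉ R} :=
    norm_setIntegral_le_of_norm_le_const_ae' (measure_lt_top _ _)
      ((ae_uniformRaters_ncard N m).mono fun R hR hi => h R hR i hi)
  rw [integral_sub .of_finite .of_finite, setIntegral_const, ← hint, ← hreal, smul_eq_mul,
    Real.norm_eq_abs] at hbound
  rw [← hreal] at hpos
  rw [ProbabilityTheory.cond, integral_smul_measure, ENNReal.toReal_inv, smul_eq_mul,
    ← measureReal_def]
  set P := (networkLaw lam N m).real {ω | i ∉ ω.2}
  set I := ∫ ω in {ω | i ∉ ω.2}, userScore t r ω i ∂(networkLaw lam N m)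
  have : P⁻¹ * I - L = (I - P * L) / P := by
    field_simp
  rwa [this, abs_div, abs_of_pos hpos, div_le_iff₀ hpos]

end Raters

end TrustNetwork

theorem proposition2 (lam t r k : ℝ) (hlam : 0 ≤ lam) (ht0 : 0 ≤ t) (ht1 : t ≤ 1)
    (hr0 : 0 < r) (hr1 : r ≤ 1) (m : ℕ → ℕ) (hm : ∀ᶠ N : ℕ in atTop, m N < N)
    (hk : Tendsto (fun N : ℕ => (m N : ℝ) / N) atTop (𝓝 k)) :
    Tendsto (fun N : ℕ => ∫ ω, TrustNetwork.nonRaterMean t r ω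
        ∂(TrustNetwork.networkLaw lam N (m N))) atTop
      (𝓝 (t * r * k * (1 - Real.exp (-lam)) / (1 - t * (1 - k) * (1 - Real.exp (-lam))))) ∧
    ∀ ε > 0, ∀ᶠ N : ℕ in atTop, ∀ i : Fin N,
      |∫ ω, TrustNetwork.userScore t r ω i
          ∂(ProbabilityTheory.cond (TrustNetwork.networkLaw lam N (m N)) {ω | i ∉ ω.2}) -
        t * r * k * (1 - Real.exp (-lam)) / (1 - t * (1 - k) * (1 - Real.exp (-lam)))| < ε := by
  have key := fun ε (hε : 0 < ε) => TrustNetwork.eventually_abs_integral_userScore_sub_lt hlam ht0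
    ht1 hr0.le hm hk (half_pos hε)
  refine ⟨Metric.tendsto_nhds.2 fun ε hε => ?_, fun ε hε => ?_⟩
  · filter_upwards [key ε hε, hm] with N hN hmN
    exact (TrustNetwork.abs_integral_nonRaterMean_sub_le hmN
      fun R hR i hi => (hN R hR i hi).le).trans_lt (half_lt_self hε)
  · filter_upwards [key ε hε, hm] with N hN hmN i
    exact (TrustNetwork.abs_integral_cond_userScore_sub_le hmN
      (fun R hR i hi => (hN R hR i hi).le) i).trans_lt (half_lt_self hε)
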